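/- Let $\chi_1,\chi_2$ be primitive Dirichlet characters modulo $q_1,q_2>1$, let $k\ge 3$ be an integer with $\chi_1(-1)\chi_2(-1)=(-1)^k$, and for $\operatorname{Im} z>0$ let $$E_{\chi_1,\chi_2,k}(z)=\frac12\sum_{\substack{c,d\in\mathbb Z\\ \gcd(c,d)=1}}\frac{\chi_1(c)\chi_2(d)}{(cq_2z+d)^k}.$$ There exist absolute constants $\varepsilon>0$ and $K$ such that the following holds for all such $q_1,q_2,\chi_1,\chi_2$ and all such $k\ge K$. Let $\ell\ge 1$ be an integer with $\gcd(\ell,q_2)=\gcd(\ell+1,q_2)=1$ and $\ell\le\varepsilon\sqrt k$. Then, counting zeros with multiplicity, $E_{\chi_1,\chi_2,k}$ has exactly one zero $z=x+iy$ in the region $$-\tfrac12<x\le\tfrac12,\qquad \frac{k-1}{2\pi(\ell+1)}\le y\le\frac{k-1}{2\pi\ell}.$$ Moreover, if $x_0\in(-\tfrac12,\tfrac12]$ is the number with $e^{2\pi i x_0}=-\overline{\chi_2(\ell)}\,\chi_2(\ell+1)$, then, again counting zeros with multiplicity, $E_{\chi_1,\chi_2,k}$ has exactly one zero in the closed rectangle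 $$x_0-\tfrac12\le x\le x_0+\tfrac12,\qquad \frac{k-1}{2\pi(\ell+1)}\le y\le\frac{k-1}{2\pi\ell}.$$ -/

import Mathlib

noncomputable section

/-- The newform Eisenstein series of weight `k` attached to the Dirichlet characters `χ₁` mod `q₁`
and `χ₂` mod `q₂`, namely `(1/2) ∑ χ₁(c) χ₂(d) / (c q₂ z + d) ^ k` over all pairs of coprime
integers `(c, d)`. For `k ≥ 3` and `Im z > 0` the series converges absolutely. -/
def newformEisenstein {q₁ q₂ : ℕ} (χ₁ : DirichletCharacter ℂ q₁) (χ₂ : DirichletCharacter ℂ q₂)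
    (k : ℕ) (z : ℂ) : ℂ :=
  (1 / 2) * ∑' v : {v : ℤ × ℤ // IsCoprime v.1 v.2},
    χ₁ (v.1.1 : ZMod q₁) * χ₂ (v.1.2 : ZMod q₂) /
      ((v.1.1 : ℂ) * (q₂ : ℂ) * z + (v.1.2 : ℂ)) ^ k

/-- The height `y_n = (k - 1) / (2 π n)`. -/
def yHeight (k n : ℕ) : ℝ := ((k : ℝ) - 1) / (2 * Real.pi * (n : ℝ))

/-- The points `x + i y` with `-1/2 < x ≤ 1/2` and `y_{ℓ+1} ≤ y ≤ y_ℓ`. -/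
def stripRegion (k l : ℕ) : Set ℂ :=
  {z : ℂ | -(1 / 2 : ℝ) < z.re ∧ z.re ≤ 1 / 2 ∧ yHeight k (l + 1) ≤ z.im ∧ z.im ≤ yHeight k l}

/-- The closed rectangle of points `x + i y` with `x₀ - 1/2 ≤ x ≤ x₀ + 1/2` and
`y_{ℓ+1} ≤ y ≤ y_ℓ`. -/
def centredRegion (x₀ : ℝ) (k l : ℕ) : Set ℂ :=
  {z : ℂ | x₀ - 1 / 2 ≤ z.re ∧ z.re ≤ x₀ + 1 / 2 ∧
    yHeight k (l + 1) ≤ z.im ∧ z.im ≤ yHeight k l}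

/-- `f` has exactly one zero in `S`, counted with multiplicity: there is a unique zero of `f` in
`S`, `f` is analytic there, and it vanishes to order one. -/
def HasExactlyOneZeroIn (f : ℂ → ℂ) (S : Set ℂ) : Prop :=
  ∃ z ∈ S, f z = 0 ∧ analyticOrderAt f z = 1 ∧ ∀ w ∈ S, f w = 0 → w = z

end

/-!
By Lipschitz's formula and primitivity of `χ₂`, the Eisenstein series of weight `N + 1` is a nonzero
multiple of `F w = ∑ m ^ N * b m * w ^ m` at `w = exp (2 π i z)`, where the `b m` are bounded and
close to `χ₂⁻¹ m`. For `y_{l+1} ≤ Im z ≤ y_l` and `N ≥ 64 (l + 1) ^ 2` the moduli of the terms fall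
by a factor of at least `1000` at each step away from the indices `l` and `l + 1`. Let `w₁` be the
point where these two terms cancel and put `s = w / w₁`. Divided by its `l`-th term, `F` is then a
small perturbation of `1 - s`, so it has a single zero, which is simple and has `s` close to `1`. On
the line `Re z = x₀ - 1/2` the real part of `s` is not positive, so there is no zero there and the
closed rectangle has as many zeros as the half-open period strip that it closes up.
-/

open Complex Metric Set Topology

theorem one_add_le_exp_sub_sq {x : ℝ} (hx : |x| ≤ 1) : 1 + x ≤ Real.exp (x - x ^ 2 / 9) := by
  obtain ⟨h₁, h₂⟩ := abs_le.mp hx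
  calc 1 + x ≤ (x / 2 + 1) ^ 2 * (-(x ^ 2 / 9) + 1) := by
        nlinarith [mul_nonneg (sq_nonneg x) (by nlinarith : 0 ≤ 9 / 4 - (1 + x / 2) ^ 2)]
    _ ≤ Real.exp (x / 2) ^ 2 * Real.exp (-(x ^ 2 / 9)) := by
        gcongr
        · nlinarith
        · linarith
        · exact Real.add_one_le_exp _
        · exact Real.add_one_le_exp _
    _ = Real.exp (x - x ^ 2 / 9) := by
        rw [← Real.exp_nat_mul, ← Real.exp_add]
        push_cast
        ring_nf

theorem exp_neg_seven_le : Real.exp (-7) ≤ 1 / 1000 := by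
  have h : (1000 : ℝ) ≤ Real.exp 1 ^ 7 :=
    calc (1000 : ℝ) ≤ 2.7 ^ 7 := by norm_num
      _ ≤ Real.exp 1 ^ 7 := by gcongr; linarith [Real.exp_one_gt_d9]
  rw [← Real.exp_nat_mul] at h
  rw [Real.exp_neg, ← one_div]
  exact one_div_le_one_div_of_le (by norm_num) (by simpa using h)

theorem one_add_pow_le_exp {N : ℕ} {x : ℝ} (hx : |x| ≤ 1) (hN : 64 ≤ N * x ^ 2) :
    (1 + x) ^ N ≤ 1 / 1000 * Real.exp (N * x) := by
  calc (1 + x) ^ N ≤ Real.exp (x - x ^ 2 / 9) ^ N :=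
        pow_le_pow_left₀ (by linarith [neg_abs_le x]) (one_add_le_exp_sub_sq hx) N
    _ = Real.exp (-(N * x ^ 2 / 9)) * Real.exp (N * x) := by
        rw [← Real.exp_nat_mul, ← Real.exp_add]
        ring_nf
    _ ≤ Real.exp (-7) * Real.exp (N * x) := by gcongr; linarith
    _ ≤ 1 / 1000 * Real.exp (N * x) := by gcongr; exact exp_neg_seven_le

theorem sixty_four_le_mul_inv_sq {N n : ℕ} (hn : 0 < n) (hN : 64 * n ^ 2 ≤ N) :
    64 ≤ N * (1 / n : ℝ) ^ 2 := by
  rw [div_pow, one_pow, mul_one_div, le_div_iff₀ (by positivity)]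
  exact_mod_cast hN

theorem one_add_inv_pow_le_exp {N n : ℕ} (hn : 0 < n) (hN : 64 * n ^ 2 ≤ N) :
    (1 + 1 / n : ℝ) ^ N ≤ 1 / 1000 * Real.exp (N / n) := by
  have h := one_add_pow_le_exp (x := 1 / n)
    (by simpa using Nat.cast_inv_le_one n) (sixty_four_le_mul_inv_sq hn hN)
  rwa [mul_one_div] at h

theorem one_sub_inv_pow_le_exp {N n : ℕ} (hn : 0 < n) (hN : 64 * n ^ 2 ≤ N) :
    (1 - 1 / n : ℝ) ^ N ≤ 1 / 1000 * Real.exp (-(N / n)) := by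
  have h := one_add_pow_le_exp (x := -(1 / n))
    (by simpa using Nat.cast_inv_le_one n) (by rw [neg_sq]; exact sixty_four_le_mul_inv_sq hn hN)
  rwa [← sub_eq_add_neg, mul_neg, mul_one_div] at h

theorem div_succ_pow_mem_Icc {N n : ℕ} (hn : 0 < n) (hN : 64 * (n + 1) ^ 2 ≤ N) :
    (n / (n + 1 : ℕ) : ℝ) ^ N ∈
      Icc (1000 * Real.exp (-(N / n))) (1 / 1000 * Real.exp (-(N / (n + 1 : ℕ)))) := by
  have : (0 : ℝ) < n := Nat.cast_pos.mpr hn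
  constructor
  · have h := one_add_inv_pow_le_exp hn (le_trans (by gcongr; exact n.le_succ) hN)
    rw [show (n / (n + 1 : ℕ) : ℝ) = (1 + 1 / n : ℝ)⁻¹ by push_cast; field_simp, inv_pow,
      Real.exp_neg, le_inv_comm₀ (by positivity) (by positivity), mul_inv, inv_inv]
    exact h.trans_eq (by norm_num)
  · rw [show (n / (n + 1 : ℕ) : ℝ) = 1 - 1 / (n + 1 : ℕ) by push_cast; field_simp; ring]
    exact one_sub_inv_pow_le_exp n.succ_pos hN

theorem succ_pow_mul_pow_le {N n m : ℕ} {r : ℝ} (hn : 0 < n) (hN : 64 * n ^ 2 ≤ N) (hnm : n ≤ m)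
    (hr₀ : 0 ≤ r) (hr : r ≤ Real.exp (-(N / n))) :
    ((m + 1 : ℕ) : ℝ) ^ N * r ^ (m + 1) ≤ 1 / 1000 * ((m : ℝ) ^ N * r ^ m) := by
  have : (0 : ℝ) < n := Nat.cast_pos.mpr hn
  have hm : (m : ℝ) ≠ 0 := Nat.cast_ne_zero.mpr (hn.trans_le hnm).ne'
  have hratio : (1 + 1 / m : ℝ) ^ N * r ≤ 1 / 1000 :=
    calc (1 + 1 / m : ℝ) ^ N * r ≤ (1 + 1 / n) ^ N * Real.exp (-(N / n)) := by gcongr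
      _ ≤ 1 / 1000 * Real.exp (N / n) * Real.exp (-(N / n)) := by
        gcongr
        exact one_add_inv_pow_le_exp hn hN
      _ = 1 / 1000 := by rw [mul_assoc, ← Real.exp_add, add_neg_cancel, Real.exp_zero, mul_one]
  have hsucc : ((m + 1 : ℕ) : ℝ) = m * (1 + 1 / m) := by push_cast; field_simp
  calc ((m + 1 : ℕ) : ℝ) ^ N * r ^ (m + 1) = (1 + 1 / m : ℝ) ^ N * r * ((m : ℝ) ^ N * r ^ m) := by
        rw [hsucc, mul_pow]
        ring
    _ ≤ 1 / 1000 * ((m : ℝ) ^ N * r ^ m) := by gcongr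

theorem pow_mul_pow_le_succ {N n m : ℕ} {r : ℝ} (hN : 64 * n ^ 2 ≤ N) (hmn : m + 1 ≤ n)
    (hr : Real.exp (-(N / n)) ≤ r) :
    (m : ℝ) ^ N * r ^ m ≤ 1 / 1000 * (((m + 1 : ℕ) : ℝ) ^ N * r ^ (m + 1)) := by
  have hr₀ : 0 < r := (Real.exp_pos _).trans_le hr
  have hratio : (1 - 1 / (m + 1 : ℕ) : ℝ) ^ N ≤ 1 / 1000 * r :=
    calc (1 - 1 / (m + 1 : ℕ) : ℝ) ^ N ≤ (1 - 1 / n) ^ N := by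
          have := Nat.one_sub_one_div_cast_nonneg (α := ℝ) (m + 1)
          gcongr
      _ ≤ 1 / 1000 * Real.exp (-(N / n)) := one_sub_inv_pow_le_exp (by lia) hN
      _ ≤ 1 / 1000 * r := by gcongr
  have hpred : (m : ℝ) = (m + 1 : ℕ) * (1 - 1 / (m + 1 : ℕ)) := by
    push_cast
    field_simp
    ring
  calc (m : ℝ) ^ N * r ^ m
      = (1 - 1 / (m + 1 : ℕ) : ℝ) ^ N * (((m + 1 : ℕ) : ℝ) ^ N * r ^ m) := by
        nth_rewrite 1 [hpred]
        rw [mul_pow]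
        ring
    _ ≤ 1 / 1000 * r * (((m + 1 : ℕ) : ℝ) ^ N * r ^ m) := by gcongr
    _ = 1 / 1000 * (((m + 1 : ℕ) : ℝ) ^ N * r ^ (m + 1)) := by ring

theorem sum_range_le_of_le_mul_succ {a : ℕ → ℝ} {q : ℝ} (hq₀ : 0 ≤ q) (hq₁ : q < 1)
    {n : ℕ} (ha : 0 ≤ a 0) (h : ∀ m < n, a m ≤ q * a (m + 1)) :
    ∑ m ∈ Finset.range n, a m ≤ q / (1 - q) * a n := by
  have hq : 0 < 1 - q := sub_pos.mpr hq₁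
  induction n with
  | zero => simp only [Finset.range_zero, Finset.sum_empty]; positivity
  | succ n ih =>
    calc ∑ m ∈ Finset.range (n + 1), a m ≤ q / (1 - q) * a n + a n := by
          rw [Finset.sum_range_succ]
          gcongr
          exact ih fun m hm => h m (hm.trans n.lt_succ_self)
      _ = 1 / (1 - q) * a n := by field_simp; ring
      _ ≤ 1 / (1 - q) * (q * a (n + 1)) := by gcongr; exact h n n.lt_succ_self
      _ = q / (1 - q) * a (n + 1) := by ring

theorem tsum_succ_le_of_succ_le_mul {a : ℕ → ℝ} {q : ℝ} (hq₀ : 0 ≤ q) (hq₁ : q < 1)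
    (ha : ∀ m, 0 ≤ a m) (h : ∀ m, a (m + 1) ≤ q * a m) :
    Summable a ∧ ∑' m, a (m + 1) ≤ q / (1 - q) * a 0 := by
  have hgeom (m : ℕ) : a m ≤ q ^ m * a 0 := le_geom hq₀ m fun k _ => h k
  have hsum := (hasSum_geometric_of_lt_one hq₀ hq₁).mul_right (a 0)
  have hsum' := (hasSum_geometric_of_lt_one hq₀ hq₁).mul_right (q * a 0)
  have ha' : Summable a := .of_nonneg_of_le ha hgeom hsum.summable
  refine ⟨ha', ((summable_nat_add_iff 1).mpr ha').tsum_le_tsum (fun m => ?_) hsum'.summable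
    |>.trans_eq (hsum'.tsum_eq.trans (by ring))⟩
  exact (hgeom (m + 1)).trans_eq (by ring)

theorem norm_tsum_sub_add_le {E : Type*} [NormedAddCommGroup E] [CompleteSpace E] {f : ℕ → E}
    {a : ℕ → ℝ} {q : ℝ} {l : ℕ} (hq₀ : 0 ≤ q) (hq₁ : q < 1) (hf : ∀ m, ‖f m‖ ≤ a m)
    (hlow : ∀ m < l, a m ≤ q * a (m + 1)) (hhigh : ∀ m, l < m → a (m + 1) ≤ q * a m) :
    ‖∑' m, f m - (f l + f (l + 1))‖ ≤ q / (1 - q) * (a l + a (l + 1)) := by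
  have ha (m : ℕ) : 0 ≤ a m := (norm_nonneg _).trans (hf m)
  obtain ⟨hasum, htail⟩ := tsum_succ_le_of_succ_le_mul hq₀ hq₁ (a := fun m => a (m + (l + 1)))
    (fun m => ha _) fun m => by simpa only [add_right_comm] using hhigh (m + (l + 1)) (by lia)
  have hfsum : Summable f :=
    .of_norm_bounded ((summable_nat_add_iff (l + 1)).mp hasum) hf
  have hsplit := hfsum.sum_add_tsum_nat_add (l + 2)
  rw [Finset.sum_range_succ, Finset.sum_range_succ] at hsplit
  have hhead : ‖∑ m ∈ Finset.range l, f m‖ ≤ q / (1 - q) * a l :=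
    (norm_sum_le_of_le _ fun m _ => hf m).trans (sum_range_le_of_le_mul_succ hq₀ hq₁ (ha 0) hlow)
  have htail' : ‖∑' m, f (m + (l + 2))‖ ≤ q / (1 - q) * a (l + 1) := by
    refine (tsum_of_norm_bounded ((summable_nat_add_iff 1).mpr hasum).hasSum fun m => ?_).trans
      (htail.trans_eq (by rw [zero_add]))
    exact (hf _).trans_eq (by congr 1; lia)
  rw [← hsplit]
  calc _ = ‖∑ m ∈ Finset.range l, f m + ∑' m, f (m + (l + 2))‖ := by congr 1; abel
    _ ≤ _ := norm_add_le _ _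
    _ ≤ _ := by rw [mul_add]; gcongr

theorem norm_deriv_le_of_mapsTo_closedBall {g : ℂ → ℂ} {c s : ℂ} {R M : ℝ} (hR : 2 * M < R)
    (hg : DifferentiableOn ℂ g (ball c R)) (hmaps : MapsTo g (ball c R) (closedBall c M))
    (hs : s ∈ closedBall c M) : ‖deriv g s‖ ≤ 2 * M / R := by
  have hM : 0 ≤ M := dist_nonneg.trans (mem_closedBall.mp hs)
  have hsub : closedBall s (R / 2) ⊆ ball c R :=
    closedBall_subset_ball' (by linarith [mem_closedBall.mp hs])
  have h := norm_deriv_le_of_forall_mem_sphere_norm_le (f := fun t => g t - c) (c := s)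
    (R := R / 2) (C := M) (by linarith) ((hg.sub_const c).diffContOnCl_ball hsub) fun t ht =>
      mem_closedBall_iff_norm.mp (hmaps (hsub (sphere_subset_closedBall ht)))
  rw [deriv_sub_const] at h
  exact h.trans_eq (by field_simp)

theorem exists_unique_fixedPoint_of_mapsTo_closedBall {g : ℂ → ℂ} {c : ℂ} {R M : ℝ} (hM : 0 ≤ M)
    (hR : 2 * M < R) (hg : DifferentiableOn ℂ g (ball c R))
    (hmaps : MapsTo g (ball c R) (closedBall c M)) :
    ∃ s ∈ closedBall c M, g s = s ∧ ∀ t ∈ ball c R, g t = t → t = s := by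
  have hsub : closedBall c M ⊆ ball c R := closedBall_subset_ball (by linarith)
  have hmaps' : MapsTo g (closedBall c M) (closedBall c M) := hmaps.mono_left hsub
  have hlip : LipschitzOnWith (2 * M / R).toNNReal g (closedBall c M) :=
    (convex_closedBall c M).lipschitzOnWith_of_nnnorm_deriv_le
      (fun s hs => hg.differentiableAt (isOpen_ball.mem_nhds (hsub hs))) fun s hs =>
        NNReal.le_toNNReal_of_coe_le (norm_deriv_le_of_mapsTo_closedBall hR hg hmaps hs)
  have hcontr : ContractingWith (2 * M / R).toNNReal (hmaps'.restrict g _ _) :=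
    ⟨by rw [Real.toNNReal_lt_one, div_lt_one (by linarith)]; exact hR,
      hlip.mapsToRestrict hmaps'⟩
  obtain ⟨s, hs, hfix, -⟩ := hcontr.exists_fixedPoint' isClosed_closedBall.isComplete hmaps'
    (mem_closedBall_self hM) (edist_ne_top _ _)
  refine ⟨s, hs, hfix, fun t ht hfix' => ?_⟩
  have ht' : t ∈ closedBall c M := by
    rw [← hfix']
    exact hmaps ht
  exact congrArg Subtype.val (hcontr.fixedPoint_unique' (x := ⟨t, ht'⟩) (y := ⟨s, hs⟩)
    (Subtype.ext hfix') (Subtype.ext hfix))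

theorem hasExactlyOneZeroIn_ball_of_norm_add_sub_le {H : ℂ → ℂ} {c : ℂ} {R M : ℝ} (hM : 0 ≤ M)
    (hR : 2 * M < R) (hH : DifferentiableOn ℂ H (ball c R))
    (hle : ∀ s ∈ ball c R, ‖H s - (c - s)‖ ≤ M) : HasExactlyOneZeroIn H (ball c R) := by
  -- The zeros of `H` are the fixed points of the contraction `s ↦ H s + s`.
  have hg : DifferentiableOn ℂ (fun s => H s + s) (ball c R) := hH.add differentiableOn_id
  have hmaps : MapsTo (fun s => H s + s) (ball c R) (closedBall c M) := fun s hs => by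
    rw [mem_closedBall_iff_norm, add_sub_right_comm, sub_add]
    exact hle s hs
  obtain ⟨s, hs, hfix, huniq⟩ := exists_unique_fixedPoint_of_mapsTo_closedBall hM hR hg hmaps
  have hs' : s ∈ ball c R := closedBall_subset_ball (by linarith) hs
  have hnhds : ball c R ∈ 𝓝 s := isOpen_ball.mem_nhds hs'
  have hzero : H s = 0 := add_eq_right.mp hfix
  have hderiv : deriv H s ≠ 0 := fun h0 => by
    have hle1 := norm_deriv_le_of_mapsTo_closedBall hR hg hmaps hs
    rw [deriv_fun_add (hH.differentiableAt hnhds) differentiableAt_fun_id, h0, deriv_id'',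
      zero_add, norm_one, le_div_iff₀ (by linarith)] at hle1
    linarith
  exact ⟨s, hs', hzero,
    (hH.analyticAt hnhds).analyticOrderAt_eq_one_of_zero_deriv_ne_zero hzero hderiv,
    fun t ht h => huniq t ht (add_eq_right.mpr h)⟩

theorem HasExactlyOneZeroIn.of_subset {f : ℂ → ℂ} {S T : Set ℂ} (h : HasExactlyOneZeroIn f S)
    (hST : S ⊆ T) (hzero : ∀ z ∈ T, f z = 0 → z ∈ S) : HasExactlyOneZeroIn f T := by
  obtain ⟨z, hz, h0, hord, huniq⟩ := h
  exact ⟨z, hST hz, h0, hord, fun w hw hw0 => huniq w (hzero w hw hw0) hw0⟩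

theorem HasExactlyOneZeroIn.of_comp {f F u e : ℂ → ℂ} {S T : Set ℂ}
    (hF : HasExactlyOneZeroIn F T) (hbij : BijOn e S T) (he : ∀ z ∈ S, AnalyticAt ℂ e z)
    (he' : ∀ z ∈ S, deriv e z ≠ 0) (hu : ∀ z ∈ S, AnalyticAt ℂ u z) (hu₀ : ∀ z ∈ S, u z ≠ 0)
    (hf : ∀ z ∈ S, f =ᶠ[𝓝 z] u * F ∘ e) : HasExactlyOneZeroIn f S := by
  obtain ⟨w, hw, hw0, hord, huniq⟩ := hF
  obtain ⟨z, hz, rfl⟩ := hbij.surjOn hw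
  have hFan : AnalyticAt ℂ F (e z) := by
    by_contra hna
    simp [analyticOrderAt_of_not_analyticAt hna] at hord
  refine ⟨z, hz, ?_, ?_, fun v hv hv0 => hbij.injOn hv hz (huniq _ (hbij.mapsTo hv) ?_)⟩
  · simp [(hf z hz).eq_of_nhds, hw0]
  · rw [analyticOrderAt_congr (hf z hz), analyticOrderAt_mul (hu z hz) (hFan.comp (he z hz)),
      (hu z hz).analyticOrderAt_eq_zero.mpr (hu₀ z hz), zero_add,
      analyticOrderAt_comp_of_deriv_ne_zero (he z hz) (he' z hz), hord]
  · rw [(hf v hv).eq_of_nhds] at hv0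
    exact (mul_eq_zero.mp hv0).resolve_left (hu₀ v hv)

/-! ### Two dominant terms of a power series -/

/-- The power series `∑ m ^ N * b m * w ^ m`: the Fourier expansion at `∞` of an Eisenstein series
of weight `N + 1`, as a function of `w = exp (2 π i z)`. -/
noncomputable def weightedPowerSeries (N : ℕ) (b : ℕ → ℂ) (w : ℂ) : ℂ :=
  ∑' m : ℕ, (m : ℂ) ^ N * b m * w ^ m

section WeightedPowerSeries

variable {N : ℕ} {b : ℕ → ℂ} {M : ℝ}

theorem norm_pow_mul_mul_pow_le (hb : ∀ m, ‖b m‖ ≤ M) {w : ℂ} {r : ℝ} (hw : ‖w‖ ≤ r) (m : ℕ) :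
    ‖(m : ℂ) ^ N * b m * w ^ m‖ ≤ M * ((m : ℝ) ^ N * r ^ m) := by
  have hM : 0 ≤ M := (norm_nonneg _).trans (hb m)
  rw [norm_mul, norm_mul, norm_pow, norm_pow, norm_natCast]
  calc (m : ℝ) ^ N * ‖b m‖ * ‖w‖ ^ m ≤ (m : ℝ) ^ N * M * r ^ m := by gcongr; exact hb m
    _ = M * ((m : ℝ) ^ N * r ^ m) := by ring

theorem summable_weightedPowerSeries (hb : ∀ m, ‖b m‖ ≤ M) {w : ℂ} (hw : ‖w‖ < 1) :
    Summable fun m : ℕ => (m : ℂ) ^ N * b m * w ^ m :=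
  .of_norm_bounded
    ((summable_pow_mul_geometric_of_norm_lt_one N (r := ‖w‖) (by rwa [norm_norm])).mul_left M)
    (norm_pow_mul_mul_pow_le hb le_rfl)

theorem weightedPowerSeries_const_mul (N : ℕ) (c : ℂ) (b : ℕ → ℂ) (w : ℂ) :
    weightedPowerSeries N (fun m => c * b m) w = c * weightedPowerSeries N b w := by
  simp only [weightedPowerSeries, ← tsum_mul_left]
  exact tsum_congr fun m => by ring

theorem weightedPowerSeries_sum_mul {ι : Type*} [Fintype ι] {c : ι → ℂ} {b : ι → ℕ → ℂ}
    (hb : ∀ i m, ‖b i m‖ ≤ M) {w : ℂ} (hw : ‖w‖ < 1) :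
    weightedPowerSeries N (fun m => ∑ i, c i * b i m) w =
      ∑ i, c i * weightedPowerSeries N (b i) w := by
  simp only [weightedPowerSeries, ← tsum_mul_left]
  rw [← Summable.tsum_finsetSum fun i _ => (summable_weightedPowerSeries (hb i) hw).mul_left (c i)]
  refine tsum_congr fun m => ?_
  rw [Finset.mul_sum, Finset.sum_mul]
  exact Finset.sum_congr rfl fun i _ => by ring

theorem weightedPowerSeries_eq_tsum_pnat (hN : N ≠ 0) (w : ℂ) :
    weightedPowerSeries N b w = ∑' m : ℕ+, ((m : ℕ) : ℂ) ^ N * b m * w ^ (m : ℕ) :=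
  (tsum_pnat_eq_tsum_of_eq_zero (f := fun m : ℕ => (m : ℂ) ^ N * b m * w ^ m) (by simp [hN])).symm

theorem natCast_pow_le_two_mul_norm (N n : ℕ) {c : ℂ} (hc : 1 / 2 ≤ ‖c‖) :
    (n : ℝ) ^ N ≤ 2 * ‖(n : ℂ) ^ N * c‖ := by
  rw [norm_mul, norm_pow, norm_natCast]
  nlinarith [pow_nonneg (Nat.cast_nonneg (α := ℝ) n) N]

theorem differentiableAt_weightedPowerSeries (hb : ∀ m, ‖b m‖ ≤ M) {w : ℂ} (hw : ‖w‖ < 1) :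
    DifferentiableAt ℂ (weightedPowerSeries N b) w := by
  obtain ⟨r, hwr, hr⟩ := exists_between hw
  have hr₀ : 0 ≤ r := (norm_nonneg w).trans hwr.le
  have hd : DifferentiableOn ℂ (weightedPowerSeries N b) (ball 0 r) :=
    differentiableOn_tsum_of_summable_norm
      ((summable_pow_mul_geometric_of_norm_lt_one N (r := r)
        (by rwa [Real.norm_of_nonneg hr₀])).mul_left M)
      (fun m => by fun_prop) isOpen_ball fun m v hv =>
        norm_pow_mul_mul_pow_le hb (mem_ball_zero_iff.mp hv).le m
  exact hd.differentiableAt (isOpen_ball.mem_nhds (mem_ball_zero_iff.mpr hwr))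

end WeightedPowerSeries

/-- The annulus on which the terms of index `l` and `l + 1` of `∑ m ^ N * w ^ m` dominate: the
modulus of the `m`-th term is stationary in `m` where `‖w‖ = exp (-N / m)`. -/
def dominanceAnnulus (N l : ℕ) : Set ℂ :=
  {w | ‖w‖ ∈ Icc (Real.exp (-(N / l))) (Real.exp (-(N / (l + 1 : ℕ))))}

theorem ne_zero_of_mem_dominanceAnnulus {N l : ℕ} {w : ℂ} (hw : w ∈ dominanceAnnulus N l) : w ≠ 0 :=
  norm_pos_iff.mp ((Real.exp_pos _).trans_le hw.1)

/-- The point at which the terms of index `l` and `l + 1` of `∑ m ^ N * b m * w ^ m` cancel. -/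
noncomputable def balancePoint (N : ℕ) (b : ℕ → ℂ) (l : ℕ) : ℂ :=
  -((l : ℂ) ^ N * b l) / (((l + 1 : ℕ) : ℂ) ^ N * b (l + 1))

/-- The weight `N` is large enough, and the bounded coefficients `b` are large enough at `l` and
`l + 1`, for these two indices to dominate `∑ m ^ N * b m * w ^ m` on `dominanceAnnulus N l`. -/
structure IsDominantPair (N : ℕ) (b : ℕ → ℂ) (l : ℕ) : Prop where
  pos : 0 < l
  sq_le : 64 * (l + 1) ^ 2 ≤ N
  norm_le : ∀ m, ‖b m‖ ≤ 2
  half_le : 1 / 2 ≤ ‖b l‖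
  half_le_succ : 1 / 2 ≤ ‖b (l + 1)‖

namespace IsDominantPair

variable {N l : ℕ} {b : ℕ → ℂ}

theorem sq_le' (h : IsDominantPair N b l) : 64 * l ^ 2 ≤ N :=
  le_trans (by gcongr; exact l.le_succ) h.sq_le

theorem weight_pos (h : IsDominantPair N b l) : 0 < N :=
  lt_of_lt_of_le (by positivity) h.sq_le

theorem leading_ne_zero (h : IsDominantPair N b l) : (l : ℂ) ^ N * b l ≠ 0 :=
  mul_ne_zero (pow_ne_zero _ (Nat.cast_ne_zero.mpr h.pos.ne'))
    (norm_pos_iff.mp (by linarith [h.half_le]))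

theorem leading_succ_ne_zero (h : IsDominantPair N b l) :
    ((l + 1 : ℕ) : ℂ) ^ N * b (l + 1) ≠ 0 :=
  mul_ne_zero (pow_ne_zero _ (Nat.cast_ne_zero.mpr l.succ_ne_zero))
    (norm_pos_iff.mp (by linarith [h.half_le_succ]))

theorem balancePoint_ne_zero (h : IsDominantPair N b l) : balancePoint N b l ≠ 0 :=
  div_ne_zero (neg_ne_zero.mpr h.leading_ne_zero) h.leading_succ_ne_zero

theorem norm_lt_one (h : IsDominantPair N b l) {w : ℂ} (hw : w ∈ dominanceAnnulus N l) :
    ‖w‖ < 1 := by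
  have hN := h.weight_pos
  exact hw.2.trans_lt (Real.exp_lt_one_iff.mpr (neg_lt_zero.mpr (by positivity)))

theorem norm_weightedPowerSeries_sub_le (h : IsDominantPair N b l) {w : ℂ}
    (hw : w ∈ dominanceAnnulus N l) :
    ‖weightedPowerSeries N b w -
        ((l : ℂ) ^ N * b l * w ^ l + ((l + 1 : ℕ) : ℂ) ^ N * b (l + 1) * w ^ (l + 1))‖ ≤
      2 / 999 * ((l : ℝ) ^ N * ‖w‖ ^ l + ((l + 1 : ℕ) : ℝ) ^ N * ‖w‖ ^ (l + 1)) := by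
  have key := norm_tsum_sub_add_le (l := l) (q := 1 / 1000) (by norm_num) (by norm_num)
    (norm_pow_mul_mul_pow_le (N := N) h.norm_le (le_refl ‖w‖))
    (fun m hm => by linarith [pow_mul_pow_le_succ h.sq_le' hm hw.1])
    (fun m hm => by
      linarith [succ_pow_mul_pow_le l.succ_pos h.sq_le hm (norm_nonneg w) hw.2])
  exact key.trans_eq (by ring)

theorem norm_div_sub_le (h : IsDominantPair N b l) {w : ℂ} (hw : w ∈ dominanceAnnulus N l) :
    ‖weightedPowerSeries N b w / ((l : ℂ) ^ N * b l * w ^ l) - (1 - w / balancePoint N b l)‖ ≤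
      (1 + ‖w / balancePoint N b l‖) / 200 := by
  have hw₀ := ne_zero_of_mem_dominanceAnnulus hw
  have hA₀ := h.leading_ne_zero
  have hB₀ := h.leading_succ_ne_zero
  have hlA := natCast_pow_le_two_mul_norm N l h.half_le
  have hlB := natCast_pow_le_two_mul_norm N (l + 1) h.half_le_succ
  have hmain := h.norm_weightedPowerSeries_sub_le hw
  rw [balancePoint]
  generalize (l : ℂ) ^ N * b l = A at *
  generalize ((l + 1 : ℕ) : ℂ) ^ N * b (l + 1) = B at *
  have hdiv : weightedPowerSeries N b w / (A * w ^ l) - (1 - w / (-A / B)) =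
      (weightedPowerSeries N b w - (A * w ^ l + B * w ^ (l + 1))) / (A * w ^ l) := by
    field_simp
    ring
  rw [hdiv, norm_div, div_le_iff₀ (norm_pos_iff.mpr (mul_ne_zero hA₀ (pow_ne_zero _ hw₀)))]
  calc _ ≤ 2 / 999 * ((l : ℝ) ^ N * ‖w‖ ^ l + ((l + 1 : ℕ) : ℝ) ^ N * ‖w‖ ^ (l + 1)) := hmain
    _ ≤ 1 / 400 * (2 * ‖A‖ * ‖w‖ ^ l + 2 * ‖B‖ * ‖w‖ ^ (l + 1)) :=
      mul_le_mul (by norm_num) (by gcongr) (by positivity) (by norm_num)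
    _ = (1 + ‖w / (-A / B)‖) / 200 * ‖A * w ^ l‖ := by
      rw [norm_mul, norm_div, norm_div, norm_neg, norm_pow]
      field_simp
      ring

theorem norm_div_balancePoint_sub_one_le (h : IsDominantPair N b l) {w : ℂ}
    (hw : w ∈ dominanceAnnulus N l) (hzero : weightedPowerSeries N b w = 0) :
    ‖w / balancePoint N b l - 1‖ ≤ 1 / 80 := by
  have hle := h.norm_div_sub_le hw
  rw [hzero, zero_div, zero_sub, neg_sub] at hle
  have htri := norm_sub_norm_le (w / balancePoint N b l) 1
  rw [norm_one] at htri
  linarith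

theorem balancePoint_mul_mem_dominanceAnnulus (h : IsDominantPair N b l) {s : ℂ}
    (hs : s ∈ ball (1 : ℂ) (1 / 2)) : balancePoint N b l * s ∈ dominanceAnnulus N l := by
  have hbl := h.half_le
  have hbl' := h.half_le_succ
  obtain ⟨hs₁, hs₂⟩ : 1 / 2 ≤ ‖s‖ ∧ ‖s‖ ≤ 3 / 2 := by
    have hdist := abs_le.mp ((abs_norm_sub_norm_le s 1).trans (mem_ball_iff_norm.mp hs).le)
    rw [norm_one] at hdist
    constructor <;> linarith
  have hratio₁ : 1 / 4 ≤ ‖b l‖ / ‖b (l + 1)‖ := by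
    rw [le_div_iff₀ (by linarith)]
    linarith [h.norm_le (l + 1)]
  have hratio₂ : ‖b l‖ / ‖b (l + 1)‖ ≤ 4 := by
    rw [div_le_iff₀ (by linarith)]
    linarith [h.norm_le l]
  obtain ⟨hpow₁, hpow₂⟩ := div_succ_pow_mem_Icc h.pos h.sq_le
  have hnorm : ‖balancePoint N b l * s‖ =
      (l / (l + 1 : ℕ) : ℝ) ^ N * (‖b l‖ / ‖b (l + 1)‖ * ‖s‖) := by
    rw [balancePoint, norm_mul, norm_div, norm_neg, norm_mul, norm_mul, norm_pow, norm_pow,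
      norm_natCast, norm_natCast]
    ring
  constructor
  · calc Real.exp (-(N / l)) ≤ 1000 * Real.exp (-(N / l)) * (1 / 4 * (1 / 2)) := by
          linarith [Real.exp_pos (-(N / l))]
      _ ≤ (l / (l + 1 : ℕ) : ℝ) ^ N * (‖b l‖ / ‖b (l + 1)‖ * ‖s‖) := by gcongr
      _ = ‖balancePoint N b l * s‖ := hnorm.symm
  · calc ‖balancePoint N b l * s‖
        = (l / (l + 1 : ℕ) : ℝ) ^ N * (‖b l‖ / ‖b (l + 1)‖ * ‖s‖) := hnorm
      _ ≤ 1 / 1000 * Real.exp (-(N / (l + 1 : ℕ))) * (4 * (3 / 2)) := by gcongr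
      _ ≤ Real.exp (-(N / (l + 1 : ℕ))) := by linarith [Real.exp_pos (-(N / (l + 1 : ℕ)))]

theorem hasExactlyOneZeroIn_ball (h : IsDominantPair N b l) :
    HasExactlyOneZeroIn (fun s => weightedPowerSeries N b (balancePoint N b l * s) /
      ((l : ℂ) ^ N * b l * (balancePoint N b l * s) ^ l)) (ball 1 (1 / 2)) := by
  have hmem {s : ℂ} (hs : s ∈ ball (1 : ℂ) (1 / 2)) := h.balancePoint_mul_mem_dominanceAnnulus hs
  refine hasExactlyOneZeroIn_ball_of_norm_add_sub_le (M := 1 / 80) (by norm_num) (by norm_num)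
    (fun s hs => ?_) fun s hs => ?_
  · have hF := differentiableAt_weightedPowerSeries (N := N) h.norm_le (h.norm_lt_one (hmem hs))
    have hden : (l : ℂ) ^ N * b l * (balancePoint N b l * s) ^ l ≠ 0 :=
      mul_ne_zero h.leading_ne_zero
        (pow_ne_zero _ (ne_zero_of_mem_dominanceAnnulus (hmem hs)))
    exact ((hF.comp s (by fun_prop)).div (by fun_prop) hden).differentiableWithinAt
  · have hle := h.norm_div_sub_le (hmem hs)
    rw [mul_div_cancel_left₀ _ h.balancePoint_ne_zero] at hle
    have htri := norm_sub_norm_le s 1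
    rw [norm_one] at htri
    linarith [mem_ball_iff_norm.mp hs]

theorem hasExactlyOneZeroIn (h : IsDominantPair N b l) :
    HasExactlyOneZeroIn (weightedPowerSeries N b) (dominanceAnnulus N l) := by
  have hw₁ := h.balancePoint_ne_zero
  have hzero : HasExactlyOneZeroIn (fun s => weightedPowerSeries N b (balancePoint N b l * s) /
      ((l : ℂ) ^ N * b l * (balancePoint N b l * s) ^ l))
      ((balancePoint N b l * ·) ⁻¹' dominanceAnnulus N l) := by
    refine h.hasExactlyOneZeroIn_ball.of_subset
      (fun s hs => h.balancePoint_mul_mem_dominanceAnnulus hs) fun s hs hs₀ => ?_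
    have hF := (div_eq_zero_iff.mp hs₀).resolve_right (mul_ne_zero h.leading_ne_zero
      (pow_ne_zero _ (ne_zero_of_mem_dominanceAnnulus hs)))
    have hle := h.norm_div_balancePoint_sub_one_le hs hF
    rw [mul_div_cancel_left₀ _ hw₁] at hle
    exact mem_ball_iff_norm.mpr (hle.trans_lt (by norm_num))
  refine hzero.of_comp (e := (· / balancePoint N b l)) (u := fun w => (l : ℂ) ^ N * b l * w ^ l)
    ?_ (by fun_prop) (fun w _ => ?_) (by fun_prop) (fun w hw => ?_) fun w hw => ?_
  · refine InvOn.bijOn (f' := (balancePoint N b l * ·))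
      ⟨fun w _ => mul_div_cancel₀ w hw₁, fun s _ => mul_div_cancel_left₀ s hw₁⟩ (fun w hw => ?_)
      fun s hs => hs
    rwa [mem_preimage, mul_div_cancel₀ w hw₁]
  · simpa only [deriv_div_const, deriv_id''] using one_div_ne_zero hw₁
  · exact mul_ne_zero h.leading_ne_zero (pow_ne_zero _ (ne_zero_of_mem_dominanceAnnulus hw))
  · filter_upwards [isOpen_ne.mem_nhds (ne_zero_of_mem_dominanceAnnulus hw)] with v hv
    simp only [Pi.mul_apply, Function.comp_apply, mul_div_cancel₀ _ hw₁]
    exact (mul_div_cancel₀ _ (mul_ne_zero h.leading_ne_zero (pow_ne_zero _ hv))).symm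

theorem re_div_balancePoint_pos (h : IsDominantPair N b l) {w : ℂ} (hw : w ∈ dominanceAnnulus N l)
    (hzero : weightedPowerSeries N b w = 0) : 0 < (w / balancePoint N b l).re := by
  have hre := (abs_le.mp (abs_re_le_norm (w / balancePoint N b l - 1))).1
  rw [sub_re, one_re] at hre
  linarith [h.norm_div_balancePoint_sub_one_le hw hzero]

end IsDominantPair

/-! ### The sum over coprime pairs and the sum over all pairs -/

/-- The summand of the newform Eisenstein series at an arbitrary, not necessarily coprime, pair of
integers. -/
noncomputable def newformSummand {q₁ q₂ : ℕ} (χ₁ : DirichletCharacter ℂ q₁)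
    (χ₂ : DirichletCharacter ℂ q₂) (k : ℕ) (z : ℂ) (v : ℤ × ℤ) : ℂ :=
  χ₁ (v.1 : ZMod q₁) * χ₂ (v.2 : ZMod q₂) / ((v.1 : ℂ) * (q₂ : ℂ) * z + (v.2 : ℂ)) ^ k

theorem natCast_mul_im_pos {n : ℕ} (hn : 0 < n) {z : ℂ} (hz : 0 < z.im) :
    0 < ((n : ℂ) * z).im := by
  simpa [mul_im] using mul_pos (Nat.cast_pos.mpr hn) hz

/-- The map `(n, v) ↦ n v` from positive integers times primitive vectors to `ℤ × ℤ`. -/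
def scaleCoprime (p : ℕ+ × {v : ℤ × ℤ // IsCoprime v.1 v.2}) : ℤ × ℤ :=
  (((p.1 : ℕ) : ℤ) * p.2.1.1, ((p.1 : ℕ) : ℤ) * p.2.1.2)

theorem scaleCoprime_injective : Function.Injective scaleCoprime := by
  rintro ⟨n, ⟨⟨a, b⟩, h⟩⟩ ⟨n', ⟨⟨a', b'⟩, h'⟩⟩ heq
  simp only [scaleCoprime, Prod.mk.injEq] at heq
  have hgcd := congrArg₂ Int.gcd heq.1 heq.2
  rw [Int.gcd_mul_left, Int.gcd_mul_left, Int.isCoprime_iff_gcd_eq_one.mp h,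
    Int.isCoprime_iff_gcd_eq_one.mp h'] at hgcd
  obtain rfl : n = n' := PNat.eq (by simpa using hgcd)
  have hn₀ : ((n : ℕ) : ℤ) ≠ 0 := by exact_mod_cast n.ne_zero
  obtain rfl := mul_left_cancel₀ hn₀ heq.1
  obtain rfl := mul_left_cancel₀ hn₀ heq.2
  rfl

theorem mem_range_scaleCoprime {v : ℤ × ℤ} (hv : v ≠ 0) : v ∈ range scaleCoprime := by
  have hgcd : 0 < Int.gcd v.1 v.2 := Nat.pos_of_ne_zero fun h =>
    hv (Prod.ext (Int.gcd_eq_zero_iff.mp h).1 (Int.gcd_eq_zero_iff.mp h).2)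
  refine ⟨(⟨Int.gcd v.1 v.2, hgcd⟩,
    ⟨(v.1 / (Int.gcd v.1 v.2 : ℤ), v.2 / (Int.gcd v.1 v.2 : ℤ)),
      Int.isCoprime_iff_gcd_eq_one.mpr (Int.gcd_div_gcd_div_gcd hgcd)⟩), ?_⟩
  exact Prod.ext (Int.mul_ediv_cancel' (Int.gcd_dvd_left ..))
    (Int.mul_ediv_cancel' (Int.gcd_dvd_right ..))

section NewformSummand

variable {q₁ q₂ : ℕ} (χ₁ : DirichletCharacter ℂ q₁) (χ₂ : DirichletCharacter ℂ q₂) {k : ℕ} {z : ℂ}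

theorem norm_mul_dirichletCharacter_le_one (a : ZMod q₁) (b : ZMod q₂) : ‖χ₁ a * χ₂ b‖ ≤ 1 := by
  rw [norm_mul]
  exact mul_le_one₀ (χ₁.norm_le_one a) (norm_nonneg _) (χ₂.norm_le_one b)

theorem summable_newformSummand (hq₂ : 0 < q₂) (hk : 3 ≤ k) (hz : 0 < z.im) :
    Summable (newformSummand χ₁ χ₂ k z) := by
  have h := summable_prod_eisSummand hk ⟨(q₂ : ℂ) * z, natCast_mul_im_pos hq₂ hz⟩
  refine .of_norm_bounded h.norm fun v => ?_
  rw [newformSummand, norm_div, EisensteinSeries.eisSummand]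
  simp only [Matrix.cons_val_zero, Matrix.cons_val_one, zpow_neg, zpow_natCast, norm_inv]
  rw [div_eq_mul_inv, ← mul_assoc]
  exact mul_le_of_le_one_left (by positivity) (norm_mul_dirichletCharacter_le_one χ₁ χ₂ _ _)

theorem newformSummand_neg (hpar : χ₁ (-1) * χ₂ (-1) = (-1) ^ k) (v : ℤ × ℤ) :
    newformSummand χ₁ χ₂ k z (-v) = newformSummand χ₁ χ₂ k z v := by
  simp only [newformSummand, Prod.fst_neg, Prod.snd_neg, Int.cast_neg]
  rw [← neg_one_mul (v.1 : ZMod q₁), ← neg_one_mul (v.2 : ZMod q₂), map_mul, map_mul,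
    show -(v.1 : ℂ) * (q₂ : ℂ) * z + -(v.2 : ℂ) = -1 * ((v.1 : ℂ) * (q₂ : ℂ) * z + v.2) by ring,
    mul_pow, mul_mul_mul_comm, hpar]
  exact mul_div_mul_left _ _ (pow_ne_zero _ (by norm_num))

theorem newformSummand_natMul (n : ℕ) (v : ℤ × ℤ) :
    newformSummand χ₁ χ₂ k z (n * v.1, n * v.2) =
      χ₁ (n : ZMod q₁) * χ₂ (n : ZMod q₂) / (n : ℂ) ^ k * newformSummand χ₁ χ₂ k z v := by
  simp only [newformSummand]
  push_cast
  rw [map_mul, map_mul, show (n : ℂ) * (v.1 : ℂ) * (q₂ : ℂ) * z + n * (v.2 : ℂ) =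
    n * ((v.1 : ℂ) * (q₂ : ℂ) * z + v.2) by ring, mul_pow, div_mul_div_comm]
  ring

theorem summable_norm_mul_dirichletCharacter_div_pow (hk : 1 < k) :
    Summable fun n : ℕ => ‖χ₁ (n : ZMod q₁) * χ₂ (n : ZMod q₂) / (n : ℂ) ^ k‖ := by
  refine .of_nonneg_of_le (fun _ => norm_nonneg _) (fun n => ?_)
    (Real.summable_one_div_nat_pow.mpr hk)
  rw [norm_div, norm_pow, norm_natCast]
  gcongr
  exact norm_mul_dirichletCharacter_le_one χ₁ χ₂ _ _

theorem tsum_mul_dirichletCharacter_div_pow_ne_zero (hk : 1 < k) :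
    ∑' n : ℕ, χ₁ (n : ZMod q₁) * χ₂ (n : ZMod q₂) / (n : ℂ) ^ k ≠ 0 := by
  let f : ℕ →*₀ ℂ :=
    { toFun := fun n => χ₁ (n : ZMod q₁) * χ₂ (n : ZMod q₂) / (n : ℂ) ^ k
      map_zero' := by simp [show k ≠ 0 by omega]
      map_one' := by simp
      map_mul' := fun m n => by push_cast; rw [map_mul, map_mul]; ring }
  have hprod := EulerProduct.exp_tsum_primes_log_eq_tsum (f := f)
    (summable_norm_mul_dirichletCharacter_div_pow χ₁ χ₂ hk)
  exact hprod ▸ exp_ne_zero _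

theorem tsum_newformSummand_eq_mul (hq₁ : 1 < q₁) (hq₂ : 0 < q₂) (hk : 3 ≤ k) (hz : 0 < z.im) :
    ∑' v, newformSummand χ₁ χ₂ k z v =
      (∑' n : ℕ, χ₁ (n : ZMod q₁) * χ₂ (n : ZMod q₂) / (n : ℂ) ^ k) *
        ∑' v : {v : ℤ × ℤ // IsCoprime v.1 v.2}, newformSummand χ₁ χ₂ k z v := by
  have : Fact (1 < q₁) := ⟨hq₁⟩
  rw [← tsum_pnat_eq_tsum_of_eq_zero (by simp [show k ≠ 0 by omega]),
    tsum_mul_tsum_of_summable_norm, ← scaleCoprime_injective.tsum_eq]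
  · exact tsum_congr fun p => newformSummand_natMul χ₁ χ₂ _ _
  · refine fun v hv => mem_range_scaleCoprime fun hv₀ => hv ?_
    simp [hv₀, newformSummand, MulChar.map_nonunit χ₁ not_isUnit_zero]
  · exact (summable_norm_mul_dirichletCharacter_div_pow χ₁ χ₂ (by omega)).comp_injective
      PNat.coe_injective
  · exact (summable_newformSummand χ₁ χ₂ hq₂ hk hz).norm.subtype _

theorem tsum_newformSummand_eq_two_mul (hq₁ : 1 < q₁) (hq₂ : 0 < q₂) (hk : 3 ≤ k)
    (hz : 0 < z.im) (hpar : χ₁ (-1) * χ₂ (-1) = (-1) ^ k) :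
    ∑' v, newformSummand χ₁ χ₂ k z v =
      2 * ∑' c : ℕ+, χ₁ (c : ℕ) *
        ∑' d : ℤ, χ₂ (d : ZMod q₂) / ((q₂ : ℂ) * ((c : ℕ) * z) + d) ^ k := by
  have : Fact (1 < q₁) := ⟨hq₁⟩
  have hs := summable_newformSummand χ₁ χ₂ hq₂ hk hz
  have hrow_zero : ∑' d : ℤ, newformSummand χ₁ χ₂ k z (0, d) = 0 := by
    simp [newformSummand, MulChar.map_nonunit χ₁ not_isUnit_zero]
  have hrow_neg : Function.Even fun c : ℤ => ∑' d : ℤ, newformSummand χ₁ χ₂ k z (c, d) :=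
    fun c => (tsum_comp_neg _).symm.trans
      (tsum_congr fun d => newformSummand_neg χ₁ χ₂ hpar (c, d))
  rw [hs.tsum_prod, tsum_int_eq_zero_add_two_mul_tsum_pnat hrow_neg hs.prod,
    hrow_zero, zero_add, nsmul_eq_mul, Nat.cast_ofNat]
  congr 1
  refine tsum_congr fun c => ?_
  rw [← tsum_mul_left]
  refine tsum_congr fun d => ?_
  rw [newformSummand, Int.cast_natCast, Int.cast_natCast, mul_div_assoc]
  congr 3
  ring

end NewformSummand

/-! ### Fourier expansion -/

theorem tsum_int_eq_sum_zmod {E : Type*} [NormedAddCommGroup E] [CompleteSpace E] {q : ℕ}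
    [NeZero q] {f : ℤ → E} (hf : Summable f) :
    ∑' d, f d = ∑ j : ZMod q, ∑' m : ℤ, f (m * q + j.val) := by
  obtain ⟨n, rfl⟩ := Nat.exists_eq_succ_of_ne_zero (NeZero.ne q)
  let e : ZMod (n + 1) × ℤ ≃ ℤ := (Equiv.prodComm _ _).trans (Int.divModEquiv (n + 1)).symm
  have hs : Summable fun p => f (e p) := e.summable_iff.mpr hf
  rw [← e.tsum_eq, hs.tsum_prod, tsum_fintype]
  rfl

section PeriodicFunctions

variable {q : ℕ} [NeZero q] {N : ℕ} {τ : ℂ}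

theorem exp_two_pi_I_mul_add_div_pow (τ : ℂ) (j : ZMod q) (n : ℕ) :
    cexp (2 * Real.pi * I * (τ + j.val / q)) ^ n =
      cexp (2 * Real.pi * I * τ) ^ n * ZMod.stdAddChar ((n : ZMod q) * j) := by
  have hj : ZMod.stdAddChar j = cexp (2 * Real.pi * I * j.val / q) := by
    simpa using ZMod.stdAddChar_coe (N := q) (j.val : ℤ)
  rw [← nsmul_eq_mul, AddChar.map_nsmul_eq_pow, hj, ← mul_pow, ← exp_add]
  congr 2
  ring

theorem tsum_residue_class (hN : 1 ≤ N) (hτ : 0 < τ.im) (j : ZMod q) :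
    ∑' m : ℤ, 1 / ((q : ℂ) * τ + ((m * q + j.val : ℤ) : ℂ)) ^ (N + 1) =
      (-2 * Real.pi * I) ^ (N + 1) / N.factorial / (q : ℂ) ^ (N + 1) *
        weightedPowerSeries N (fun n => ZMod.stdAddChar ((n : ZMod q) * j))
          (cexp (2 * Real.pi * I * τ)) := by
  have hq₀ : (q : ℂ) ≠ 0 := NeZero.ne _
  have him : 0 < (τ + (j.val : ℂ) / q).im := by
    rw [add_im, div_natCast_im, natCast_im, zero_div, add_zero]
    exact hτ
  have hLipschitz : ∑' m : ℤ, 1 / (τ + (j.val : ℂ) / q + m) ^ (N + 1) =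
      ((-2 * Real.pi * I) ^ (N + 1) / N.factorial) *
        ∑' n : ℕ, (n : ℂ) ^ N * cexp (2 * Real.pi * I * (τ + (j.val : ℂ) / q)) ^ n :=
    EisensteinSeries.qExpansion_identity hN ⟨_, him⟩
  have hscale (m : ℤ) : 1 / ((q : ℂ) * τ + ((m * q + j.val : ℤ) : ℂ)) ^ (N + 1) =
      1 / (q : ℂ) ^ (N + 1) * (1 / (τ + (j.val : ℂ) / q + m) ^ (N + 1)) := by
    rw [div_mul_div_comm, one_mul, ← mul_pow]
    congr 2
    push_cast
    field_simp
    ring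
  rw [tsum_congr hscale, tsum_mul_left, hLipschitz, weightedPowerSeries, ← mul_assoc,
    one_div_mul_eq_div]
  congr 1
  refine tsum_congr fun n => ?_
  rw [exp_two_pi_I_mul_add_div_pow]
  ring

theorem summable_div_add_intCast_pow (Φ : ZMod q → ℂ) (hN : 1 ≤ N) (z : ℂ) :
    Summable fun d : ℤ => Φ d / (z + d) ^ (N + 1) := by
  obtain ⟨M, hM⟩ := (Set.finite_range fun j => ‖Φ j‖).bddAbove
  have hs := (EisensteinSeries.linear_right_summable z 1
    (k := ((N + 1 : ℕ) : ℤ)) (by exact_mod_cast (by omega : 2 ≤ N + 1))).norm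
  refine .of_norm_bounded (hs.mul_left M) fun d => ?_
  rw [norm_div, zpow_natCast, norm_inv, Int.cast_one, one_mul, div_eq_mul_inv]
  gcongr
  exact hM (mem_range_self _)

theorem tsum_div_pow_eq_dft (Φ : ZMod q → ℂ) (hN : 1 ≤ N) (hτ : 0 < τ.im) :
    ∑' d : ℤ, Φ d / ((q : ℂ) * τ + d) ^ (N + 1) =
      (-2 * Real.pi * I) ^ (N + 1) / N.factorial / (q : ℂ) ^ (N + 1) *
        weightedPowerSeries N (fun n => ZMod.dft Φ (-n)) (cexp (2 * Real.pi * I * τ)) := by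
  have hw : ‖cexp (2 * Real.pi * I * τ)‖ < 1 :=
    UpperHalfPlane.norm_exp_two_pi_I_lt_one ⟨τ, hτ⟩
  have hclass (j : ZMod q) (m : ℤ) : Φ ((m * q + j.val : ℤ) : ZMod q) = Φ j := by simp
  have hdft : (fun n : ℕ => ZMod.dft Φ (-n)) = fun n : ℕ =>
      ∑ j, Φ j * ZMod.stdAddChar ((n : ZMod q) * j) := by
    funext n
    simp only [ZMod.dft_apply, smul_eq_mul, mul_neg, neg_neg]
    exact Finset.sum_congr rfl fun j _ => by rw [mul_comm, mul_comm j]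
  have hnorm (j : ZMod q) (n : ℕ) : ‖ZMod.stdAddChar ((n : ZMod q) * j)‖ ≤ 1 :=
    (AddChar.norm_apply _ _).le
  rw [tsum_int_eq_sum_zmod (q := q) (summable_div_add_intCast_pow Φ hN _), hdft,
    weightedPowerSeries_sum_mul hnorm hw, Finset.mul_sum]
  refine Finset.sum_congr rfl fun j _ => ?_
  rw [mul_left_comm, ← tsum_residue_class hN hτ j, ← tsum_mul_left]
  exact tsum_congr fun m => by rw [hclass, mul_one_div]

theorem gaussSum_stdAddChar_ne_zero {χ : DirichletCharacter ℂ q} (hχ : χ.IsPrimitive) :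
    gaussSum χ ZMod.stdAddChar ≠ 0 := by
  intro h₀
  have hdft : ZMod.dft (χ : ZMod q → ℂ) = 0 := by
    funext a
    rw [hχ.fourierTransform_eq_inv_mul_gaussSum, h₀, mul_zero, Pi.zero_apply]
  simpa using congrFun ((LinearEquiv.map_eq_zero_iff _).mp hdft) 1

theorem exists_tsum_dirichletCharacter_div_pow {χ : DirichletCharacter ℂ q} (hχ : χ.IsPrimitive)
    (hN : 1 ≤ N) :
    ∃ D : ℂ, D ≠ 0 ∧ ∀ τ : ℂ, 0 < τ.im → ∑' d : ℤ, χ d / ((q : ℂ) * τ + d) ^ (N + 1) =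
      D * weightedPowerSeries N (fun n => χ⁻¹ n) (cexp (2 * Real.pi * I * τ)) := by
  refine ⟨(-2 * Real.pi * I) ^ (N + 1) / N.factorial / (q : ℂ) ^ (N + 1) *
    gaussSum χ ZMod.stdAddChar, mul_ne_zero ?_ (gaussSum_stdAddChar_ne_zero hχ), fun τ hτ => ?_⟩
  · simp [Real.pi_ne_zero, N.factorial_ne_zero, NeZero.ne q]
  · have hcoeff : (fun n : ℕ => ZMod.dft χ (-n)) =
        fun n : ℕ => gaussSum χ ZMod.stdAddChar * χ⁻¹ n := by
      funext n
      rw [hχ.fourierTransform_eq_inv_mul_gaussSum, neg_neg, mul_comm]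
    rw [tsum_div_pow_eq_dft χ hN hτ, hcoeff, weightedPowerSeries_const_mul]
    ring

end PeriodicFunctions

/-- The coefficients of the Fourier expansion of an Eisenstein series, normalised by the factor
`m ^ N`: the term `d = 1` contributes `b m` and the others are small when `N` is large. -/
noncomputable def twistedDivisorSum (a b : ℕ → ℂ) (N m : ℕ) : ℂ :=
  ∑ p ∈ m.divisorsAntidiagonal, a p.1 * b p.2 / (p.1 : ℂ) ^ N

section TwistedDivisorSum

variable {a b : ℕ → ℂ} {N : ℕ}

theorem pow_mul_twistedDivisorSum (a b : ℕ → ℂ) (N m : ℕ) :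
    (m : ℂ) ^ N * twistedDivisorSum a b N m =
      ∑ p ∈ m.divisorsAntidiagonal, a p.1 * ((p.2 : ℂ) ^ N * b p.2) := by
  rw [twistedDivisorSum, Finset.mul_sum]
  refine Finset.sum_congr rfl fun p hp => ?_
  have hp₀ : (p.1 : ℂ) ≠ 0 :=
    Nat.cast_ne_zero.mpr (Nat.ne_zero_of_mem_divisorsAntidiagonal hp).1
  rw [← (Nat.mem_divisorsAntidiagonal.mp hp).1, Nat.cast_mul, mul_pow]
  field_simp

theorem tsum_mul_weightedPowerSeries_pow {A B : ℝ} (ha : ∀ m, ‖a m‖ ≤ A) (hb : ∀ m, ‖b m‖ ≤ B)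
    (hN : N ≠ 0) {w : ℂ} (hw : ‖w‖ < 1) :
    ∑' c : ℕ+, a c * weightedPowerSeries N b (w ^ (c : ℕ)) =
      weightedPowerSeries N (twistedDivisorSum a b N) w := by
  let F : ℕ+ × ℕ+ → ℂ := fun p => a p.1 * ((p.2 : ℂ) ^ N * b p.2) * w ^ (p.1 * p.2 : ℕ)
  have hF : Summable F := by
    refine .of_norm_bounded ((summable_prod_mul_pow N hw).norm.mul_left (A * B)) fun p => ?_
    have hA : 0 ≤ A := (norm_nonneg _).trans (ha 0)
    calc ‖F p‖ = ‖a p.1‖ * ‖b p.2‖ * ‖(p.2 : ℂ) ^ N * w ^ (p.1 * p.2 : ℕ)‖ := by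
          simp only [F, norm_mul]
          ring
      _ ≤ A * B * ‖(p.2 : ℂ) ^ N * w ^ (p.1 * p.2 : ℕ)‖ := by
          gcongr
          exacts [ha _, hb _]
  have hF' : Summable fun x => F (sigmaAntidiagonalEquivProd x) :=
    sigmaAntidiagonalEquivProd.summable_iff.mpr hF
  calc ∑' c : ℕ+, a c * weightedPowerSeries N b (w ^ (c : ℕ)) = ∑' (c : ℕ+) (n : ℕ+), F (c, n) :=
        tsum_congr fun c => by
          rw [weightedPowerSeries_eq_tsum_pnat hN, ← tsum_mul_left]
          exact tsum_congr fun n => by simp only [F, pow_mul]; ring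
    _ = ∑' (m : ℕ+) (p : (m : ℕ).divisorsAntidiagonal), F (sigmaAntidiagonalEquivProd ⟨m, p⟩) := by
        rw [← hF.tsum_prod, ← sigmaAntidiagonalEquivProd.tsum_eq, hF'.tsum_sigma]
    _ = weightedPowerSeries N (twistedDivisorSum a b N) w := by
        rw [weightedPowerSeries_eq_tsum_pnat hN]
        refine tsum_congr fun m => ?_
        rw [pow_mul_twistedDivisorSum, Finset.sum_mul, tsum_fintype,
          ← Finset.sum_coe_sort (m : ℕ).divisorsAntidiagonal]
        refine Finset.sum_congr rfl fun p _ => ?_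
        exact congrArg (a p.1.1 * ((p.1.2 : ℂ) ^ N * b p.1.2) * w ^ ·)
          (Nat.mem_divisorsAntidiagonal.mp p.2).1

theorem inv_pow_le_of_two_le (hN : 10 ≤ N) {d : ℕ} (hd : 2 ≤ d) :
    1 / (d : ℝ) ^ N ≤ 1 / 256 * ((d : ℝ) ^ 2)⁻¹ := by
  have hd' : (2 : ℝ) ≤ d := by exact_mod_cast hd
  have hpow : 2 ^ 8 * (d : ℝ) ^ 2 ≤ (d : ℝ) ^ N :=
    calc 2 ^ 8 * (d : ℝ) ^ 2 ≤ (d : ℝ) ^ 8 * (d : ℝ) ^ 2 := by gcongr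
      _ = (d : ℝ) ^ 10 := by ring
      _ ≤ (d : ℝ) ^ N := pow_le_pow_right₀ (by linarith) hN
  calc 1 / (d : ℝ) ^ N ≤ 1 / (2 ^ 8 * (d : ℝ) ^ 2) := by gcongr
    _ = 1 / 256 * ((d : ℝ) ^ 2)⁻¹ := by field_simp; norm_num

theorem sum_divisors_erase_one_inv_sq_le (m : ℕ) :
    ∑ d ∈ m.divisors.erase 1, ((d : ℝ) ^ 2)⁻¹ ≤ 1 := by
  rcases m.eq_zero_or_pos with rfl | hm
  · simp
  have hsub : m.divisors.erase 1 ⊆ Finset.Ioc 1 m := fun d hd => by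
    have hd' := Nat.mem_divisors.mp (Finset.mem_of_mem_erase hd)
    have := Nat.pos_of_dvd_of_pos hd'.1 hm
    exact Finset.mem_Ioc.mpr ⟨by have := Finset.ne_of_mem_erase hd; omega, Nat.le_of_dvd hm hd'.1⟩
  calc ∑ d ∈ m.divisors.erase 1, ((d : ℝ) ^ 2)⁻¹ ≤ ∑ d ∈ Finset.Ioc 1 m, ((d : ℝ) ^ 2)⁻¹ :=
        Finset.sum_le_sum_of_subset_of_nonneg hsub fun _ _ _ => by positivity
    _ ≤ (↑(1 : ℕ))⁻¹ - (m : ℝ)⁻¹ := sum_Ioc_inv_sq_le_sub one_ne_zero hm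
    _ ≤ 1 := by simp

theorem norm_twistedDivisorSum_sub_le (ha : ∀ m, ‖a m‖ ≤ 1) (ha₁ : a 1 = 1)
    (hb : ∀ m, ‖b m‖ ≤ 1) (hN : 10 ≤ N) {m : ℕ} (hm : m ≠ 0) :
    ‖twistedDivisorSum a b N m - b m‖ ≤ 1 / 100 := by
  have hsplit : twistedDivisorSum a b N m - b m =
      ∑ d ∈ m.divisors.erase 1, a d * b (m / d) / (d : ℂ) ^ N := by
    rw [twistedDivisorSum, Nat.sum_divisorsAntidiagonal (fun c d => a c * b d / (c : ℂ) ^ N),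
      ← Finset.add_sum_erase _ _ (Nat.one_mem_divisors.mpr hm)]
    simp only [ha₁, Nat.cast_one, Nat.div_one, one_mul, one_pow, div_one, add_sub_cancel_left]
  have hterm (d : ℕ) (hd : d ∈ m.divisors.erase 1) :
      ‖a d * b (m / d) / (d : ℂ) ^ N‖ ≤ 1 / 256 * ((d : ℝ) ^ 2)⁻¹ := by
    have hd₂ : 2 ≤ d := by
      have := Nat.pos_of_mem_divisors (Finset.mem_of_mem_erase hd)
      have := Finset.ne_of_mem_erase hd
      omega
    rw [norm_div, norm_mul, norm_pow, norm_natCast]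
    refine le_trans ?_ (inv_pow_le_of_two_le hN hd₂)
    gcongr
    exact mul_le_one₀ (ha _) (norm_nonneg _) (hb _)
  rw [hsplit]
  refine (norm_sum_le_of_le _ hterm).trans ?_
  rw [← Finset.mul_sum]
  linarith [sum_divisors_erase_one_inv_sq_le m]

theorem norm_twistedDivisorSum_le (ha : ∀ m, ‖a m‖ ≤ 1) (ha₁ : a 1 = 1) (hb : ∀ m, ‖b m‖ ≤ 1)
    (hN : 10 ≤ N) (m : ℕ) : ‖twistedDivisorSum a b N m‖ ≤ 2 := by
  rcases eq_or_ne m 0 with rfl | hm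
  · simp [twistedDivisorSum]
  · have hsub := norm_twistedDivisorSum_sub_le ha ha₁ hb hN hm
    have htri := norm_sub_norm_le (twistedDivisorSum a b N m) (b m)
    linarith [hb m]

theorem one_half_le_norm_twistedDivisorSum (ha : ∀ m, ‖a m‖ ≤ 1) (ha₁ : a 1 = 1)
    (hb : ∀ m, ‖b m‖ ≤ 1) (hN : 10 ≤ N) {m : ℕ} (hm : m ≠ 0) (hbm : ‖b m‖ = 1) :
    1 / 2 ≤ ‖twistedDivisorSum a b N m‖ := by
  have hsub := norm_twistedDivisorSum_sub_le ha ha₁ hb hN hm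
  have htri := norm_sub_norm_le (b m) (twistedDivisorSum a b N m)
  rw [norm_sub_rev] at htri
  linarith

theorem isDominantPair_twistedDivisorSum (ha : ∀ m, ‖a m‖ ≤ 1) (ha₁ : a 1 = 1)
    (hb : ∀ m, ‖b m‖ ≤ 1) {l : ℕ} (hl : 0 < l) (hN : 64 * (l + 1) ^ 2 ≤ N) (hbl : ‖b l‖ = 1)
    (hbl' : ‖b (l + 1)‖ = 1) : IsDominantPair N (twistedDivisorSum a b N) l := by
  have hN' : 10 ≤ N := by nlinarith
  exact ⟨hl, hN, norm_twistedDivisorSum_le ha ha₁ hb hN',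
    one_half_le_norm_twistedDivisorSum ha ha₁ hb hN' hl.ne' hbl,
    one_half_le_norm_twistedDivisorSum ha ha₁ hb hN' l.succ_ne_zero hbl'⟩

end TwistedDivisorSum

theorem exists_newformEisenstein_eq_weightedPowerSeries {q₁ q₂ : ℕ} (χ₁ : DirichletCharacter ℂ q₁)
    {χ₂ : DirichletCharacter ℂ q₂} {N : ℕ} (hq₁ : 1 < q₁) (hq₂ : 0 < q₂) (hχ₂ : χ₂.IsPrimitive)
    (hpar : χ₁ (-1) * χ₂ (-1) = (-1) ^ (N + 1)) (hN : 2 ≤ N) :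
    ∃ C : ℂ, C ≠ 0 ∧ ∀ z : ℂ, 0 < z.im → newformEisenstein χ₁ χ₂ (N + 1) z =
      C * weightedPowerSeries N (twistedDivisorSum (fun m => χ₁ m) (fun m => χ₂⁻¹ m) N)
        (cexp (2 * Real.pi * I * z)) := by
  have : NeZero q₂ := ⟨hq₂.ne'⟩
  have hk : 3 ≤ N + 1 := by omega
  obtain ⟨D, hD₀, hD⟩ := exists_tsum_dirichletCharacter_div_pow hχ₂ (N := N) (by omega)
  have hL := tsum_mul_dirichletCharacter_div_pow_ne_zero χ₁ χ₂ (k := N + 1) (by omega)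
  refine ⟨D / ∑' n : ℕ, χ₁ n * χ₂ n / (n : ℂ) ^ (N + 1), div_ne_zero hD₀ hL, fun z hz => ?_⟩
  have hw : ‖cexp (2 * Real.pi * I * z)‖ < 1 :=
    UpperHalfPlane.norm_exp_two_pi_I_lt_one ⟨z, hz⟩
  have hrow (c : ℕ+) : ∑' d : ℤ, χ₂ d / ((q₂ : ℂ) * ((c : ℕ) * z) + d) ^ (N + 1) =
      D * weightedPowerSeries N (fun m => χ₂⁻¹ m) (cexp (2 * Real.pi * I * z) ^ (c : ℕ)) := by
    rw [hD _ (natCast_mul_im_pos c.pos hz), ← exp_nat_mul, mul_left_comm]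
  have hdouble : ∑' v, newformSummand χ₁ χ₂ (N + 1) z v =
      2 * (D * weightedPowerSeries N (twistedDivisorSum (fun m => χ₁ m) (fun m => χ₂⁻¹ m) N)
        (cexp (2 * Real.pi * I * z))) := by
    rw [tsum_newformSummand_eq_two_mul χ₁ χ₂ hq₁ hq₂ hk hz hpar,
      ← tsum_mul_weightedPowerSeries_pow (fun m => χ₁.norm_le_one m) (fun m => χ₂⁻¹.norm_le_one m)
        (by omega) hw, ← tsum_mul_left (a := D)]
    simp only [hrow, mul_left_comm]
  have hE : newformEisenstein χ₁ χ₂ (N + 1) z =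
      1 / 2 * ∑' v : {v : ℤ × ℤ // IsCoprime v.1 v.2}, newformSummand χ₁ χ₂ (N + 1) z v := rfl
  rw [hE, div_mul_eq_mul_div D, eq_div_iff hL]
  rw [tsum_newformSummand_eq_mul χ₁ χ₂ hq₁ hq₂ hk hz] at hdouble
  linear_combination (1 / 2 : ℂ) * hdouble

/-! ### Zeros in the period strips -/

section Periodicity

theorem norm_exp_two_pi_I_mul (z : ℂ) :
    ‖cexp (2 * Real.pi * I * z)‖ = Real.exp (-(2 * Real.pi * z.im)) := by
  rw [norm_exp]
  congr 1
  simp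

theorem exp_two_pi_I_mul_eq_iff {z w : ℂ} :
    cexp (2 * Real.pi * I * z) = cexp (2 * Real.pi * I * w) ↔ ∃ n : ℤ, z = w + n := by
  rw [exp_eq_exp_iff_exists_int]
  refine exists_congr fun n => ?_
  rw [mul_comm (n : ℂ), ← mul_add, mul_right_inj' two_pi_I_ne_zero]

theorem norm_exp_two_pi_I_mul_mem_Icc_iff {a b : ℝ} {z : ℂ} :
    ‖cexp (2 * Real.pi * I * z)‖ ∈
      Icc (Real.exp (-(2 * Real.pi * b))) (Real.exp (-(2 * Real.pi * a))) ↔ z.im ∈ Icc a b := by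
  simp only [norm_exp_two_pi_I_mul, mem_Icc, Real.exp_le_exp, neg_le_neg_iff,
    mul_le_mul_iff_right₀ Real.two_pi_pos, and_comm]

theorem bijOn_exp_two_pi_I_mul (x₀ a b : ℝ) :
    BijOn (fun z => cexp (2 * Real.pi * I * z)) (Ioc (x₀ - 1 / 2) (x₀ + 1 / 2) ×ℂ Icc a b)
      {w | ‖w‖ ∈ Icc (Real.exp (-(2 * Real.pi * b))) (Real.exp (-(2 * Real.pi * a)))} := by
  refine ⟨fun z hz => norm_exp_two_pi_I_mul_mem_Icc_iff.mpr hz.2, fun z hz w hw h => ?_,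
    fun w hw => ?_⟩
  · obtain ⟨n, rfl⟩ := exp_two_pi_I_mul_eq_iff.mp h
    have hzre := hz.1
    have hwre := hw.1
    simp only [mem_preimage, add_re, intCast_re, mem_Ioc] at hzre hwre
    have hn : |n| < 1 := by
      rify
      exact abs_lt.mpr ⟨by linarith, by linarith⟩
    rw [Int.abs_lt_one_iff.mp hn, Int.cast_zero, add_zero]
  · have hw₀ : w ≠ 0 := norm_pos_iff.mp ((Real.exp_pos _).trans_le hw.1)
    obtain ⟨n, hn, -⟩ := existsUnique_add_zsmul_mem_Ioc one_pos
      (log w / (2 * Real.pi * I)).re (x₀ - 1 / 2)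
    have hexp : cexp (2 * Real.pi * I * (log w / (2 * Real.pi * I) + n)) = w := by
      rw [exp_two_pi_I_mul_eq_iff.mpr ⟨n, rfl⟩, mul_div_cancel₀ _ two_pi_I_ne_zero, exp_log hw₀]
    refine ⟨_, ⟨?_, norm_exp_two_pi_I_mul_mem_Icc_iff.mp (hexp.symm ▸ hw)⟩, hexp⟩
    rw [mem_preimage, add_re, intCast_re]
    rwa [zsmul_one, show x₀ - 1 / 2 + 1 = x₀ + 1 / 2 by ring] at hn

theorem HasExactlyOneZeroIn.comp_exp_two_pi_I_mul {f F : ℂ → ℂ} {C : ℂ} {a b : ℝ}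
    (hF : HasExactlyOneZeroIn F
      {w | ‖w‖ ∈ Icc (Real.exp (-(2 * Real.pi * b))) (Real.exp (-(2 * Real.pi * a)))})
    (hC : C ≠ 0) (ha : 0 < a)
    (hf : ∀ z : ℂ, 0 < z.im → f z = C * F (cexp (2 * Real.pi * I * z))) (x₀ : ℝ) :
    HasExactlyOneZeroIn f (Ioc (x₀ - 1 / 2) (x₀ + 1 / 2) ×ℂ Icc a b) := by
  refine hF.of_comp (u := fun _ => C) (bijOn_exp_two_pi_I_mul x₀ a b) (fun z _ => by fun_prop)
    (fun z _ => ?_) (fun z _ => analyticAt_const) (fun z _ => hC) fun z hz => ?_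
  · have hderiv := ((hasDerivAt_id z).const_mul (2 * Real.pi * I)).cexp.deriv
    simp only [id_eq, mul_one] at hderiv
    rw [hderiv]
    exact mul_ne_zero (exp_ne_zero _) two_pi_I_ne_zero
  · have hopen : IsOpen {z : ℂ | 0 < z.im} := isOpen_lt continuous_const continuous_im
    filter_upwards [hopen.mem_nhds (ha.trans_le hz.2.1)] with v hv using hf v hv

theorem exp_two_pi_I_mul_of_re_eq_sub_half {x₀ : ℝ} {z : ℂ} (hz : z.re = x₀ - 1 / 2) :
    cexp (2 * Real.pi * I * z) =
      (Real.exp (-(2 * Real.pi * z.im)) : ℝ) * -cexp (2 * Real.pi * I * x₀) := by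
  have hsplit : 2 * Real.pi * I * z =
      ((-(2 * Real.pi * z.im) : ℝ) : ℂ) + (2 * Real.pi * I * x₀ - Real.pi * I) := by
    conv_lhs => rw [← re_add_im z, hz]
    push_cast
    linear_combination (2 * Real.pi * z.im : ℂ) * I_sq
  rw [hsplit, exp_add, ofReal_exp, exp_sub_pi_mul_I]

end Periodicity

theorem two_pi_mul_yHeight (N n : ℕ) : 2 * Real.pi * yHeight (N + 1) n = N / n := by
  rw [yHeight, Nat.cast_add_one, add_sub_cancel_right, mul_div_assoc',
    mul_div_mul_left _ _ Real.two_pi_pos.ne']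

theorem dominanceAnnulus_eq (N l : ℕ) :
    dominanceAnnulus N l = {w | ‖w‖ ∈ Icc (Real.exp (-(2 * Real.pi * yHeight (N + 1) l)))
      (Real.exp (-(2 * Real.pi * yHeight (N + 1) (l + 1))))} := by
  rw [two_pi_mul_yHeight, two_pi_mul_yHeight, dominanceAnnulus]

theorem yHeight_succ_pos {N n : ℕ} (hN : 0 < N) (hn : 0 < n) : 0 < yHeight (N + 1) n := by
  refine pos_of_mul_pos_right ?_ Real.two_pi_pos.le
  rw [two_pi_mul_yHeight]
  positivity

theorem re_div_pos_of_norm_sub_one_le {u v : ℂ} {r : ℝ} (hr : r < 1 / 3) (hu : ‖u - 1‖ ≤ r)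
    (hv : ‖v - 1‖ ≤ r) : 0 < (v / u).re := by
  have hu' : 1 - r ≤ ‖u‖ := by
    have htri := norm_sub_norm_le 1 u
    rw [norm_one, norm_sub_rev] at htri
    linarith
  have hu₀ : u ≠ 0 := norm_pos_iff.mp (by linarith)
  have hlt : ‖v / u - 1‖ < 1 := by
    rw [div_sub_one hu₀, norm_div, div_lt_one (by linarith)]
    have htri := norm_sub_le (v - 1) (u - 1)
    rw [sub_sub_sub_cancel_right] at htri
    linarith
  have hre := (abs_lt.mp ((abs_re_le_norm _).trans_lt hlt)).1
  rw [sub_re, one_re] at hre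
  linarith

theorem re_mul_div_balancePoint_nonpos {N l : ℕ} {b : ℕ → ℂ} {β β' : ℂ} {t r : ℝ} (ht : 0 ≤ t)
    (hr : r < 1 / 3) (hβ : ‖β‖ = 1) (hβ' : ‖β'‖ = 1) (hb : ‖b l - β‖ ≤ r)
    (hb' : ‖b (l + 1) - β'‖ ≤ r) : (t * (β / β') / balancePoint N b l).re ≤ 0 := by
  have hnormalize {x γ : ℂ} (hγ : ‖γ‖ = 1) (hx : ‖x - γ‖ ≤ r) : ‖x / γ - 1‖ ≤ r := by
    rwa [div_sub_one (norm_pos_iff.mp (hγ ▸ one_pos)), norm_div, hγ, div_one]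
  have hpos := re_div_pos_of_norm_sub_one_le hr (hnormalize hβ hb) (hnormalize hβ' hb')
  have hfactor : t * (β / β') / balancePoint N b l =
      ((-(t * ((l + 1 : ℕ) ^ N / l ^ N)) : ℝ) : ℂ) * (b (l + 1) / β' / (b l / β)) := by
    rw [balancePoint]
    push_cast
    simp only [div_eq_mul_inv, mul_inv, inv_neg, inv_inv]
    ring
  rw [hfactor, re_ofReal_mul]
  exact mul_nonpos_of_nonpos_of_nonneg (neg_nonpos.mpr (by positivity)) hpos.le

section PeriodStrips

variable {N l : ℕ} {b : ℕ → ℂ} {f : ℂ → ℂ} {C : ℂ}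

theorem IsDominantPair.hasExactlyOneZeroIn_periodStrip (h : IsDominantPair N b l) (hC : C ≠ 0)
    (hf : ∀ z : ℂ, 0 < z.im → f z = C * weightedPowerSeries N b (cexp (2 * Real.pi * I * z)))
    (x₀ : ℝ) :
    HasExactlyOneZeroIn f (Ioc (x₀ - 1 / 2) (x₀ + 1 / 2) ×ℂ
      Icc (yHeight (N + 1) (l + 1)) (yHeight (N + 1) l)) := by
  have hannulus := h.hasExactlyOneZeroIn
  rw [dominanceAnnulus_eq] at hannulus
  exact hannulus.comp_exp_two_pi_I_mul hC (yHeight_succ_pos h.weight_pos l.succ_pos) hf x₀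

theorem IsDominantPair.hasExactlyOneZeroIn_stripRegion (h : IsDominantPair N b l) (hC : C ≠ 0)
    (hf : ∀ z : ℂ, 0 < z.im → f z = C * weightedPowerSeries N b (cexp (2 * Real.pi * I * z))) :
    HasExactlyOneZeroIn f (stripRegion (N + 1) l) := by
  have hstrip := h.hasExactlyOneZeroIn_periodStrip hC hf 0
  rw [zero_sub, zero_add] at hstrip
  exact hstrip.of_subset (fun z hz => ⟨hz.1.1, hz.1.2, hz.2⟩)
    fun z hz _ => ⟨⟨hz.1, hz.2.1⟩, hz.2.2⟩

theorem IsDominantPair.hasExactlyOneZeroIn_centredRegion (h : IsDominantPair N b l) (hC : C ≠ 0)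
    (hf : ∀ z : ℂ, 0 < z.im → f z = C * weightedPowerSeries N b (cexp (2 * Real.pi * I * z)))
    {β β' : ℂ} {r x₀ : ℝ} (hr : r < 1 / 3) (hβ : ‖β‖ = 1) (hβ' : ‖β'‖ = 1) (hb : ‖b l - β‖ ≤ r)
    (hb' : ‖b (l + 1) - β'‖ ≤ r) (hx₀ : cexp (2 * Real.pi * I * x₀) = -(β / β')) :
    HasExactlyOneZeroIn f (centredRegion x₀ (N + 1) l) := by
  refine (h.hasExactlyOneZeroIn_periodStrip hC hf x₀).of_subset
    (fun z hz => ⟨hz.1.1.le, hz.1.2, hz.2⟩) fun z ⟨hre, hre', him⟩ hz => ?_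
  refine ⟨⟨hre.lt_of_ne fun hedge => ?_, hre'⟩, him⟩
  have hmem : cexp (2 * Real.pi * I * z) ∈ dominanceAnnulus N l := by
    rw [dominanceAnnulus_eq]
    exact norm_exp_two_pi_I_mul_mem_Icc_iff.mpr him
  have him_pos : 0 < z.im := (yHeight_succ_pos h.weight_pos l.succ_pos).trans_le him.1
  rw [hf z him_pos] at hz
  have hpos := h.re_div_balancePoint_pos hmem ((mul_eq_zero.mp hz).resolve_left hC)
  rw [exp_two_pi_I_mul_of_re_eq_sub_half hedge.symm, hx₀, neg_neg] at hpos
  exact hpos.not_ge (re_mul_div_balancePoint_nonpos (Real.exp_pos _).le hr hβ hβ' hb hb')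

end PeriodStrips

theorem norm_dirichletCharacter_natCast {q m : ℕ} (χ : DirichletCharacter ℂ q)
    (hm : m.Coprime q) : ‖χ m‖ = 1 := by
  simpa using χ.unit_norm_eq_one (ZMod.unitOfCoprime m hm)

theorem conj_mul_eq_inv_div_inv {q m n : ℕ} (χ : DirichletCharacter ℂ q) (hm : m.Coprime q) :
    starRingEnd ℂ (χ m) * χ n = χ⁻¹ m / χ⁻¹ n := by
  rw [MulChar.inv_apply_eq_inv', MulChar.inv_apply_eq_inv', div_inv_eq_mul,
    Complex.inv_eq_conj (norm_dirichletCharacter_natCast χ hm)]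

theorem theorem1p2_general {q₁ q₂ : ℕ} (χ₁ : DirichletCharacter ℂ q₁)
    (χ₂ : DirichletCharacter ℂ q₂) {k l : ℕ} (hq₁ : 1 < q₁) (hq₂ : 0 < q₂) (hχ₂ : χ₂.IsPrimitive)
    (hpar : χ₁ (-1) * χ₂ (-1) = (-1) ^ k) (hl : 1 ≤ l) (hlq : l.Coprime q₂)
    (hlq' : (l + 1).Coprime q₂) (hk : 64 * (l + 1) ^ 2 < k) :
    HasExactlyOneZeroIn (newformEisenstein χ₁ χ₂ k) (stripRegion k l) ∧
      ∀ x₀ : ℝ, cexp (2 * Real.pi * I * x₀) =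
          -(starRingEnd ℂ (χ₂ (l : ZMod q₂)) * χ₂ ((l + 1 : ℕ) : ZMod q₂)) →
        HasExactlyOneZeroIn (newformEisenstein χ₁ χ₂ k) (centredRegion x₀ k l) := by
  obtain ⟨N, rfl⟩ : ∃ N, k = N + 1 := Nat.exists_eq_add_one.mpr (by omega)
  have hN : 64 * (l + 1) ^ 2 ≤ N := Nat.lt_succ_iff.mp hk
  have hN' : 10 ≤ N := by nlinarith
  have hχ₁_le (m : ℕ) : ‖χ₁ m‖ ≤ 1 := χ₁.norm_le_one m
  have hχ₁_one : χ₁ (1 : ℕ) = 1 := by rw [Nat.cast_one, map_one]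
  have hχ₂_le (m : ℕ) : ‖χ₂⁻¹ m‖ ≤ 1 := χ₂⁻¹.norm_le_one m
  have hβ := norm_dirichletCharacter_natCast χ₂⁻¹ hlq
  have hβ' := norm_dirichletCharacter_natCast χ₂⁻¹ hlq'
  have hdom := isDominantPair_twistedDivisorSum hχ₁_le hχ₁_one hχ₂_le hl hN hβ hβ'
  have hclose {m : ℕ} (hm : m ≠ 0) :=
    norm_twistedDivisorSum_sub_le hχ₁_le hχ₁_one hχ₂_le hN' hm
  obtain ⟨C, hC, hE⟩ :=
    exists_newformEisenstein_eq_weightedPowerSeries χ₁ hq₁ hq₂ hχ₂ hpar (by omega)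
  refine ⟨hdom.hasExactlyOneZeroIn_stripRegion hC hE, fun x₀ hx₀ => ?_⟩
  rw [conj_mul_eq_inv_div_inv χ₂ hlq] at hx₀
  exact hdom.hasExactlyOneZeroIn_centredRegion hC hE (by norm_num) hβ hβ'
    (hclose (by omega)) (hclose l.succ_ne_zero) hx₀

theorem sixty_four_mul_succ_sq_lt {k l : ℕ} (hl : 1 ≤ l) (h : (l : ℝ) ≤ 1 / 20 * Real.sqrt k) :
    64 * (l + 1) ^ 2 < k := by
  have hl' : (1 : ℝ) ≤ l := by exact_mod_cast hl
  have hsq : (l : ℝ) ^ 2 ≤ k / 400 := by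
    calc (l : ℝ) ^ 2 ≤ (1 / 20 * Real.sqrt k) ^ 2 := by gcongr
      _ = (k : ℝ) / 400 := by rw [mul_pow, Real.sq_sqrt k.cast_nonneg]; ring
  have hlt : (64 : ℝ) * (l + 1) ^ 2 < k := by nlinarith
  exact_mod_cast hlt

theorem theorem1p2 :
    ∃ ε : ℝ, 0 < ε ∧ ∃ K : ℕ,
      ∀ (q₁ q₂ : ℕ) (χ₁ : DirichletCharacter ℂ q₁) (χ₂ : DirichletCharacter ℂ q₂) (k l : ℕ),
        1 < q₁ → 1 < q₂ → χ₁.IsPrimitive → χ₂.IsPrimitive →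
        3 ≤ k → χ₁ (-1) * χ₂ (-1) = (-1) ^ k →
        K ≤ k → 1 ≤ l → Nat.Coprime l q₂ → Nat.Coprime (l + 1) q₂ →
        (l : ℝ) ≤ ε * Real.sqrt (k : ℝ) →
        HasExactlyOneZeroIn (newformEisenstein χ₁ χ₂ k) (stripRegion k l) ∧
        ∀ x₀ : ℝ, -(1 / 2 : ℝ) < x₀ → x₀ ≤ 1 / 2 →
          Complex.exp (2 * Real.pi * Complex.I * x₀) =
            -(starRingEnd ℂ (χ₂ (l : ZMod q₂)) * χ₂ ((l + 1 : ℕ) : ZMod q₂)) →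
          HasExactlyOneZeroIn (newformEisenstein χ₁ χ₂ k) (centredRegion x₀ k l) := by
  refine ⟨1 / 20, by norm_num, 3,
    fun q₁ q₂ χ₁ χ₂ k l hq₁ hq₂ _ hχ₂ _ hpar _ hl hlq hlq' hlk => ?_⟩
  obtain ⟨hstrip, hcentred⟩ := theorem1p2_general χ₁ χ₂ hq₁ (by omega) hχ₂ hpar hl hlq hlq'
    (sixty_four_mul_succ_sq_lt hl hlk)
  exact ⟨hstrip, fun x₀ _ _ => hcentred x₀⟩
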